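/- Theorem 6. The game of lazy zombies and survivor is played on a finite connected simple graph $G$ with $n$ vertices, in rounds numbered $0,1,2,\dots$. In round $0$ the $k$ zombies choose their starting vertices, and then the survivor chooses its starting vertex. In every later round, first each zombie either stays where it is or moves along the first edge of a shortest path from its position to the current position of the survivor, and then the survivor stays where it is or moves to an adjacent vertex. All positions are visible to everyone. The survivor is caught as soon as it is on the same vertex as a zombie, and $k$ lazy zombies win on $G$ if they can always force this. The lazy zombie number $z_L(G)$ is the least $k$ such that $k$ lazy zombies win on $G$. A graph is outerplanar if it can be drawn in the plane without crossings with all its vertices on the outer face; equivalently, its vertices can be placed at distinct points of a circle so that the edges, drawn as straight chords, do not cross. The lazy zombie number of connected outerplanar graphs is $2$, in the following sense. (a) For every connected outerplanar graph $G$ with $n$ vertices, $z_L(G)\le 2$, with $z_L(G)=2$ if and only if a single lazy zombie does not win on $G$. Moreover, two lazy zombies can catch the survivor in fewer than $2n$ rounds (round $0$ included). (b) The value $2$ is attained: the $4$-cycle $C_4$ is a connected outerplanar graph and $z_L(C_4)=2$. -/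

import Mathlib

/-- A finite simple graph is outerplanar if it can be drawn in the plane without crossings and with
all its vertices on the outer face.  Concretely: the vertices are distinct points of the unit circle,
the edges are straight chords, and distinct edges have disjoint interiors.  (A chord meets the circle
only in its two ends, so no edge passes through a third vertex, and every vertex lies on the boundary
of the unbounded face.) -/
def IsOuterplanar {V : Type*} (G : SimpleGraph V) : Prop :=
  ∃ p : V → ℂ, Function.Injective p ∧ (∀ v, p v ∈ Metric.sphere (0 : ℂ) 1) ∧
    ∀ u v x y, G.Adj u v → G.Adj x y → s(u, v) ≠ s(x, y) →
      Disjoint (openSegment ℝ (p u) (p v)) (openSegment ℝ (p x) (p y))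

namespace LazyZombies

variable {V : Type*} (G : SimpleGraph V)

/-- With the survivor at `s`, a lazy zombie at `z` may go to `w`: either it stays still, or `zw` is
the first edge of a shortest path from `z` to `s`. -/
def ZombieStep (s z w : V) : Prop :=
  w = z ∨ ∃ (h : G.Adj z w) (p : G.Walk w s), (SimpleGraph.Walk.cons h p).length = G.dist z s

/-- The survivor stays still or moves along an edge. -/
def SurvivorStep (s s' : V) : Prop := s' = s ∨ G.Adj s s'

/-- The survivor at `s` is caught by the zombies at positions `z`. -/
def Caught {k : ℕ} (z : Fin k → V) (s : V) : Prop := ∃ i, z i = s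

/-- `CanCatch G r z s`: from the positions `z`, `s` at the end of a round, the `k` lazy zombies can
force a capture within `r` further rounds.  In a round all zombies step, seeing the position of the
survivor; if the survivor is not caught then, it steps, seeing the positions of the zombies. -/
def CanCatch {k : ℕ} : ℕ → (Fin k → V) → V → Prop
  | 0, z, s => Caught z s
  | r + 1, z, s => Caught z s ∨
      ∃ z' : Fin k → V, (∀ i, ZombieStep G s (z i) (z' i)) ∧
        (Caught z' s ∨ ∀ s', SurvivorStep G s s' → CanCatch r z' s')

/-- `k` lazy zombies can catch the survivor in (at most) `N` rounds.  The rounds are numbered from `0`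
and round `0`, which counts as one of the `N`, is the placement: the zombies choose their starting
vertices, then the survivor chooses its own. -/
def CatchInRounds (k : ℕ) : ℕ → Prop
  | 0 => False
  | N + 1 => ∃ z₀ : Fin k → V, ∀ s₀ : V, CanCatch G N z₀ s₀

/-- `k` lazy zombies win: they can choose starting vertices from which, wherever the survivor starts,
they can force a capture.  (For a finite graph, forcing a capture is the same as forcing it within
some number of rounds.) -/
def Win (k : ℕ) : Prop := ∃ z₀ : Fin k → V, ∀ s₀ : V, ∃ r, CanCatch G r z₀ s₀

/-- The lazy zombie number: the least number of lazy zombies that win. -/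
noncomputable def lazyZombieNumber : ℕ := sInf {k | Win G k}

end LazyZombies

open LazyZombies

/-! ### Formal properties of the game. -/

namespace LazyZombies

variable {V : Type*} {G : SimpleGraph V}

/-! Order the vertices around the circle. Every edge separates the open arc between its ends from
the rest (`IsNoncrossing.separates`), so zombies on both ends confine the survivor to the arc.
`canCatch_arc` shrinks this arc by induction on its size. Suppose the survivor is no farther from
the end `a` than from `c`, and let `u` be the last neighbour of `a` towards `c` inside the arc. If
the survivor is beyond `u`, then `u` starts a shortest path from `a`, and the zombie steps there. If
it is between `a` and `u`, the zombie on `a` waits while the other walks to an end of the edge `au`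
(`canCatch_walk`). Shortest paths may force that end to be `a` again, so the induction also covers a
zombie merely adjacent to an end. Each vertex removed from the arc pays for two rounds. On the
4-cycle, a survivor who stays opposite a single zombie is never caught. -/

theorem CanCatch.succ {k : ℕ} : ∀ {r : ℕ} {z : Fin k → V} {s : V},
    CanCatch G r z s → CanCatch G (r + 1) z s
  | 0, _, _, h => Or.inl h
  | _ + 1, _, _, h => by
    rcases h with h | ⟨z', hz, h⟩
    · exact Or.inl h
    · exact Or.inr ⟨z', hz, h.imp_right fun h s' hs => (h s' hs).succ⟩

theorem CanCatch.mono {k : ℕ} {r r' : ℕ} (hr : r ≤ r') {z : Fin k → V} {s : V}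
    (h : CanCatch G r z s) : CanCatch G r' z s := by
  induction hr with
  | refl => exact h
  | step _ ih => exact ih.succ

theorem CanCatch.of_caught {k : ℕ} {z : Fin k → V} {s : V} (h : Caught z s) (r : ℕ) :
    CanCatch G r z s := by
  cases r with
  | zero => exact h
  | succ r => exact Or.inl h

theorem CanCatch.comp_perm {k : ℕ} (σ : Equiv.Perm (Fin k)) : ∀ {r : ℕ} {z : Fin k → V} {s : V},
    CanCatch G r z s → CanCatch G r (z ∘ σ) s := by
  have caught : ∀ {z : Fin k → V} {s : V}, Caught z s → Caught (z ∘ σ) s := by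
    rintro z s ⟨i, hi⟩
    exact ⟨σ.symm i, by simpa using hi⟩
  intro r
  induction r with
  | zero => exact caught
  | succ r ih =>
    rintro z s (h | ⟨z', hz, h⟩)
    · exact Or.inl (caught h)
    · exact Or.inr ⟨z' ∘ σ, fun i => hz (σ i), h.imp caught fun h s' hs => ih (h s' hs)⟩

theorem CanCatch.swap {r : ℕ} {a b s : V} (h : CanCatch G r ![a, b] s) :
    CanCatch G r ![b, a] s := by
  have := h.comp_perm (Equiv.swap 0 1)
  convert this using 1
  funext i
  fin_cases i <;> simp

theorem canCatch_left (r : ℕ) (a b : V) : CanCatch G r ![a, b] a := .of_caught ⟨0, rfl⟩ r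

theorem canCatch_right (r : ℕ) (a b : V) : CanCatch G r ![a, b] b := .of_caught ⟨1, rfl⟩ r

theorem canCatch_pair_succ {r : ℕ} {a b a' b' s : V} (ha : ZombieStep G s a a')
    (hb : ZombieStep G s b b') (h : a' ≠ s → b' ≠ s → ∀ s', SurvivorStep G s s' →
      CanCatch G r ![a', b'] s') : CanCatch G (r + 1) ![a, b] s := by
  refine Or.inr ⟨![a', b'], ?_, ?_⟩
  · intro i
    fin_cases i
    · exact ha
    · exact hb
  · by_cases h1 : a' = s
    · exact Or.inl ⟨0, h1⟩
    by_cases h2 : b' = s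
    · exact Or.inl ⟨1, h2⟩
    exact Or.inr (h h1 h2)

theorem CatchInRounds.win {k N : ℕ} (h : CatchInRounds G k N) : Win G k := by
  cases N with
  | zero => exact h.elim
  | succ N =>
    obtain ⟨z, hz⟩ := h
    exact ⟨z, fun s => ⟨N, hz s⟩⟩

theorem not_win_zero [Nonempty V] : ¬ Win G 0 := by
  rintro ⟨z, hz⟩
  obtain ⟨s⟩ := ‹Nonempty V›
  obtain ⟨r, hr⟩ := hz s
  induction r generalizing z with
  | zero => exact hr.elim fun i => i.elim0
  | succ r ih =>
    rcases hr with ⟨i, -⟩ | ⟨z', -, ⟨i, -⟩ | h⟩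
    · exact i.elim0
    · exact i.elim0
    · exact ih z (fun s => hz s) (by simpa [Subsingleton.elim z z'] using h s (Or.inl rfl))

/-! ### Legal zombie moves, distances and separation. -/

theorem zombieStep_of_dist (hG : G.Connected) {s z w : V} (h : G.Adj z w)
    (hd : G.dist w s + 1 = G.dist z s) : ZombieStep G s z w := by
  obtain ⟨p, hp⟩ := hG.exists_walk_length_eq_dist w s
  exact Or.inr ⟨h, p, by simp [hp, hd]⟩

theorem zombieStep_of_adj {s z : V} (h : G.Adj z s) : ZombieStep G s z s :=
  Or.inr ⟨h, .nil, by simp [SimpleGraph.dist_eq_one_iff_adj.2 h]⟩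

theorem canCatch_of_adj (r : ℕ) {a s : V} (b : V) (h : G.Adj a s) :
    CanCatch G (r + 1) ![a, b] s :=
  canCatch_pair_succ (zombieStep_of_adj h) (Or.inl rfl) fun h _ => absurd rfl h

/-- A vertex other than `t` has a neighbour nearer to `t`. -/
theorem exists_adj_dist_succ (hG : G.Connected) {x t : V} (h : x ≠ t) :
    ∃ w, G.Adj x w ∧ G.dist w t + 1 = G.dist x t := by
  obtain ⟨p, hp⟩ := hG.exists_walk_length_eq_dist x t
  cases p with
  | nil => exact absurd rfl h
  | cons hxw q =>
    rename_i w
    refine ⟨w, hxw, ?_⟩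
    have h1 := SimpleGraph.dist_le q
    have h2 := hG.dist_triangle (u := x) (v := w) (w := t)
    have h3 := SimpleGraph.dist_eq_one_iff_adj.2 hxw
    simp only [SimpleGraph.Walk.length_cons] at hp
    omega

/-- If a shortest path from `x` to `s` may pass through `t ≠ x`, a zombie at `x` can approach `t`. -/
theorem exists_zombieStep_of_dist_add (hG : G.Connected) {x t s : V} (h : x ≠ t)
    (hd : G.dist x s = G.dist x t + G.dist t s) :
    ∃ w, ZombieStep G s x w ∧ G.Adj x w ∧ G.dist w t + 1 = G.dist x t := by
  obtain ⟨w, hw, hwt⟩ := exists_adj_dist_succ hG h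
  refine ⟨w, zombieStep_of_dist hG hw ?_, hw, hwt⟩
  have h1 := hG.dist_triangle (u := w) (v := t) (w := s)
  have h2 := hG.dist_triangle (u := x) (v := w) (w := s)
  have h3 := SimpleGraph.dist_eq_one_iff_adj.2 hw
  omega

/-- All edges leaving `R` end in `a` or `c`. -/
def Separates (G : SimpleGraph V) (R : Set V) (a c : V) : Prop :=
  ∀ x ∈ R, ∀ y, G.Adj x y → y ∈ R ∨ y = a ∨ y = c

theorem Separates.mem_support {R : Set V} {a c : V} (hR : Separates G R a c) {s x : V}
    (p : G.Walk s x) (hs : s ∈ R) (hx : x ∉ R) : a ∈ p.support ∨ c ∈ p.support := by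
  induction p with
  | nil => exact absurd hs hx
  | cons h q ih =>
    rcases hR _ hs _ h with h | rfl | rfl
    · rcases ih h hx with h | h <;> simp [h]
    · simp
    · simp

theorem dist_eq_add_of_mem_support (hG : G.Connected) {s x t : V} (p : G.Walk s x)
    (hp : p.length = G.dist s x) (ht : t ∈ p.support) :
    G.dist s x = G.dist s t + G.dist t x := by
  classical
  have h1 := SimpleGraph.dist_le (p.takeUntil t ht)
  have h2 := SimpleGraph.dist_le (p.dropUntil t ht)
  have h3 := congrArg SimpleGraph.Walk.length (p.take_spec ht)
  rw [SimpleGraph.Walk.length_append] at h3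
  have h4 := hG.dist_triangle (u := s) (v := t) (w := x)
  omega

/-- A shortest path into `R` passes `a` or `c`; this is what makes heading for one of them a legal
zombie move. -/
theorem Separates.dist_eq (hG : G.Connected) {R : Set V} {a c : V} (hR : Separates G R a c)
    {s x : V} (hs : s ∈ R) (hx : x ∉ R) :
    G.dist x s = G.dist x a + G.dist a s ∨ G.dist x s = G.dist x c + G.dist c s := by
  obtain ⟨p, hp⟩ := hG.exists_walk_length_eq_dist s x
  simp only [G.dist_comm (u := x)]
  rcases hR.mem_support p hs hx with h | h
  · left
    rw [dist_eq_add_of_mem_support hG p hp h, G.dist_comm (u := s), add_comm]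
  · right
    rw [dist_eq_add_of_mem_support hG p hp h, G.dist_comm (u := s), add_comm]

/-! ### Arcs of a noncrossing cyclic order. -/

/-- The open arc from `a` to `b`, for vertices in the cyclic order given by `f`. -/
def arc (f : V → ℤ) (a b : V) : Set V :=
  {x | (f a < f x ∧ f x < f b) ∨ (f x < f b ∧ f b < f a) ∨ (f b < f a ∧ f a < f x)}

theorem mem_arc {f : V → ℤ} {a b x : V} : x ∈ arc f a b ↔
    (f a < f x ∧ f x < f b) ∨ (f x < f b ∧ f b < f a) ∨ (f b < f a ∧ f a < f x) := Iff.rfl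

/-- Negation reverses the orientation, which makes the two ends of an arc interchangeable. -/
theorem arc_neg (f : V → ℤ) (a b : V) : arc (-f) a b = arc f b a := by
  ext x
  simp only [mem_arc, Pi.neg_apply]
  omega

/-- `f` places the vertices on a line without crossing edges. -/
def IsNoncrossing (G : SimpleGraph V) (f : V → ℤ) : Prop :=
  Function.Injective f ∧ ∀ a b c d, f a < f b → f b < f c → f c < f d → G.Adj a c → ¬ G.Adj b d

theorem IsNoncrossing.neg {f : V → ℤ} (hf : IsNoncrossing G f) : IsNoncrossing G (-f) := by
  refine ⟨fun x y h => hf.1 (neg_injective h), fun a b c d hab hbc hcd h1 h2 => ?_⟩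
  simp only [Pi.neg_apply] at hab hbc hcd
  exact hf.2 d c b a (by omega) (by omega) (by omega) h2.symm h1.symm

/-- Cyclic interlacing is linear interlacing up to rotation: four of the nine case pairs are the
rotations, the others are inconsistent. -/
theorem IsNoncrossing.not_adj {f : V → ℤ} (hf : IsNoncrossing G f) {a b c d : V}
    (hb : b ∈ arc f a c) (hd : d ∈ arc f c a) (h : G.Adj a c) : ¬ G.Adj b d := by
  intro h'
  have key := hf.2
  rw [mem_arc] at hb hd
  rcases hb with hb | hb | hb <;> rcases hd with hd | hd | hd
  · omega
  · exact key d a b c hd.1 hb.1 hb.2 h'.symm h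
  · exact key a b c d hb.1 hb.2 hd.2 h h'
  · exact key b c d a hb.1 hd.1 hd.2 h' h.symm
  · omega
  · omega
  · exact key c d a b hd.1 hd.2 hb.2 h.symm h'.symm
  · omega
  · omega

/-- An edge cuts off its arc. -/
theorem IsNoncrossing.separates {f : V → ℤ} (hf : IsNoncrossing G f) {a c : V}
    (h : G.Adj a c) : Separates G (arc f a c) a c := by
  intro x hx y hxy
  by_contra! hy
  obtain ⟨h1, h2, h3⟩ := hy
  refine hf.not_adj hx ?_ h hxy
  have := hf.1.ne h2
  have := hf.1.ne h3
  have := hf.1.ne h.ne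
  rw [mem_arc] at *
  omega

theorem notMem_arc_left {f : V → ℤ} {a c : V} : a ∉ arc f a c := by rw [mem_arc]; omega

theorem notMem_arc_right {f : V → ℤ} {a c : V} : c ∉ arc f a c := by rw [mem_arc]; omega

/-! ### The confinement strategy. -/

/-- One zombie stays on an end of the edge `au`; the other walks to one of its ends. -/
theorem canCatch_walk (hG : G.Connected) {f : V → ℤ} (hf : IsNoncrossing G f) {a u : V}
    (hau : G.Adj a u) {r : ℕ} (hu : ∀ s ∈ arc f a u, CanCatch G (r + 1) ![a, u] s)
    (ha : ∀ s ∈ arc f a u, CanCatch G (r + 1) ![a, a] s) (k : ℕ) :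
    ∀ b, b ∉ arc f a u → (G.dist b a ≤ k ∨ G.dist b u ≤ k) → ∀ s ∈ arc f a u,
      CanCatch G (k + r + 1) ![a, b] s := by
  have hsep := hf.separates hau
  induction k with
  | zero =>
    intro b _ hk s hs
    simp only [Nat.le_zero, hG.dist_eq_zero_iff] at hk
    rw [zero_add]
    rcases hk with rfl | rfl
    · exact ha s hs
    · exact hu s hs
  | succ k ih =>
    intro b hb hk s hs
    by_cases hba : b = a
    · rw [hba]
      exact (ha s hs).mono (by omega)
    by_cases hbu : b = u
    · rw [hbu]
      exact (hu s hs).mono (by omega)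
    have step : ∃ w, ZombieStep G s b w ∧ G.Adj b w ∧ (G.dist w a ≤ k ∨ G.dist w u ≤ k) := by
      have h1 := SimpleGraph.dist_eq_one_iff_adj.2 hau
      have h2 := hG.dist_triangle (u := b) (v := a) (w := u)
      have h3 := hG.dist_triangle (u := a) (v := u) (w := s)
      have h4 := hG.dist_triangle (u := u) (v := a) (w := s)
      have h5 := hG.dist_triangle (u := b) (v := u) (w := a)
      have h6 := G.dist_comm (u := u) (v := a)
      have h7 := hG.dist_triangle (u := b) (v := a) (w := s)
      have h8 := hG.dist_triangle (u := b) (v := u) (w := s)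
      -- If the shortest path found uses an end farther than `k + 1`, the near end, being adjacent
      -- to it, gives an equally short route.
      have h : (G.dist b s = G.dist b a + G.dist a s ∧ G.dist b a ≤ k + 1) ∨
          (G.dist b s = G.dist b u + G.dist u s ∧ G.dist b u ≤ k + 1) := by
        rcases hsep.dist_eq hG hs hb with h | h <;> omega
      rcases h with ⟨h, hk⟩ | ⟨h, hk⟩
      · obtain ⟨w, hw, hbw, hd⟩ := exists_zombieStep_of_dist_add hG hba h
        exact ⟨w, hw, hbw, by omega⟩
      · obtain ⟨w, hw, hbw, hd⟩ := exists_zombieStep_of_dist_add hG hbu h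
        exact ⟨w, hw, hbw, by omega⟩
    obtain ⟨w, hw, hbw, hwk⟩ := step
    have hwR : w ∉ arc f a u := fun h => by
      rcases hsep w h b hbw.symm with h | h | h
      exacts [hb h, hba h, hbu h]
    have : k + 1 + r + 1 = (k + r + 1) + 1 := by omega
    rw [this]
    refine canCatch_pair_succ (Or.inl rfl) hw fun _ _ s' hs' => ?_
    have hs'' : s' ∈ arc f a u ∨ s' = a ∨ s' = u := by
      rcases hs' with rfl | h
      · exact Or.inl hs
      · exact hsep s hs s' h
    rcases hs'' with h | rfl | rfl
    · exact ih w hwR hwk s' h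
    · exact canCatch_left _ _ _
    · exact canCatch_of_adj _ _ hau

variable [Finite V]

/-- The neighbour of `a` in the arc from `a` to `c` that is nearest to `c`. -/
theorem exists_last_adj {f : V → ℤ} {a c w : V} (hw : w ∈ arc f a c) (haw : G.Adj a w) :
    ∃ u ∈ arc f a c, G.Adj a u ∧ ∀ x ∈ arc f u c, ¬ G.Adj a x := by
  obtain ⟨u, ⟨hu, hau⟩, hmin⟩ := Set.exists_min_image {x | x ∈ arc f a c ∧ G.Adj a x}
    (fun x => (arc f x c).ncard) (Set.toFinite _) ⟨w, hw, haw⟩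
  refine ⟨u, hu, hau, fun x hx hax => ?_⟩
  have hxa : x ∈ arc f a c := by rw [mem_arc] at *; omega
  refine absurd (hmin x ⟨hxa, hax⟩) (not_le.2 (Set.ncard_lt_ncard ⟨fun y hy => ?_, fun h => ?_⟩))
  · rw [mem_arc] at *; omega
  · exact notMem_arc_left (h hx)

/-- The zombies at `a` and `b` confine the survivor to the arc from `a` to `c`, and the survivor is
not farther from `a` than from `c`. -/
theorem canCatch_of_dist_le (hG : G.Connected) {f : V → ℤ} (hf : IsNoncrossing G f) {a b c s : V}
    (hsep : Separates G (arc f a c) a c) (hb : b ∉ arc f a c) (hbc : b = c ∨ G.Adj b c) {m k : ℕ}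
    (hcard : (arc f a c).ncard ≤ m + 1)
    (hu : ∀ u ∈ arc f a c, G.Adj a u → ∀ t ∈ arc f a u, CanCatch G (2 * m + 1) ![a, u] t)
    (ha : ∀ u ∈ arc f a c, G.Adj a u → ∀ t ∈ arc f a u, CanCatch G (2 * m + 2) ![a, a] t)
    (hshort : ∀ u ∈ arc f a c, Separates G (arc f u c) u c → ∀ t ∈ arc f u c,
      CanCatch G (2 * m + G.dist u b + k) ![u, b] t)
    (hs : s ∈ arc f a c) (hd : G.dist a s ≤ G.dist c s) :
    CanCatch G (2 * (m + 1) + G.dist a b + k) ![a, b] s := by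
  have has : a ≠ s := fun h => notMem_arc_left (h ▸ hs)
  obtain ⟨w, haw, hws⟩ := exists_adj_dist_succ hG has
  have hw : w ∈ arc f a c := by
    by_contra hw
    rcases hsep.dist_eq hG hs hw with h | h <;> omega
  obtain ⟨u, hur, hau, hlast⟩ := exists_last_adj hw haw
  have hne : ∀ {x y}, x ≠ y → f x ≠ f y := fun h => hf.1.ne h
  by_cases hsu : s = u
  · have : 2 * (m + 1) + G.dist a b + k = (2 * m + 1 + G.dist a b + k) + 1 := by omega
    rw [this]
    exact canCatch_of_adj _ _ (hsu ▸ hau)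
  by_cases hsl : s ∈ arc f a u
  · refine (canCatch_walk hG hf hau (r := 2 * m + 1) (fun t ht => (hu u hur hau t ht).succ)
      (ha u hur hau) (G.dist a b) b ?_ (Or.inl G.dist_comm.le) s hsl).mono (by omega)
    intro h
    apply hb
    rw [mem_arc] at *
    omega
  · have hsr : s ∈ arc f u c := by
      have := hne hsu
      rw [mem_arc] at *
      omega
    -- From a `w` before `u`, a shortest path to `s` would pass `a`, which is farther from `s`, or
    -- `u`, making `a` at least two farther from `s` than its neighbour `u`.
    have hwu : w = u := by
      by_contra hwu
      have hwl : w ∈ arc f a u := by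
        have h1 := hne hwu
        have h2 : w ∉ arc f u c := fun h => hlast w h haw
        rw [mem_arc] at *
        omega
      have h1 := (hf.separates hau).dist_eq hG hwl hsl
      have h2 := hG.dist_triangle (u := a) (v := u) (w := s)
      have h3 := SimpleGraph.dist_eq_one_iff_adj.2 hau
      have h4 := hG.pos_dist_of_ne hwu
      simp only [G.dist_comm (u := s), G.dist_comm (v := w)] at h1
      have := G.dist_comm (u := u) (v := w)
      omega
    subst hwu
    -- An edge to `a` contradicts the choice of `w` as last neighbour; an edge back into the arc
    -- from `a` to `w` crosses `aw`.
    have hsep' : Separates G (arc f w c) w c := by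
      intro x hx y hxy
      have hxa : x ∈ arc f a c := by rw [mem_arc] at *; omega
      have hya : y ≠ a := fun h => hlast x hx (h ▸ hxy.symm)
      by_contra! hy
      obtain ⟨h1, h2, h3⟩ := hy
      have hyc := (hsep x hxa y hxy).resolve_right (by tauto)
      refine hf.not_adj (b := y) (d := x) ?_ ?_ haw hxy.symm
      · have := hne h2
        rw [mem_arc] at *
        omega
      · rw [mem_arc] at *
        omega
    have htri := hG.dist_triangle (u := w) (v := a) (w := b)
    have h1 := SimpleGraph.dist_eq_one_iff_adj.2 haw.symm
    -- Of the two rounds freed, one is this move and one covers `dist w b ≤ dist a b + 1`.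
    have : 2 * (m + 1) + G.dist a b + k = (2 * m + 1 + G.dist a b + k) + 1 := by omega
    rw [this]
    refine canCatch_pair_succ (zombieStep_of_dist hG haw hws) (Or.inl rfl) fun _ _ s' hs' => ?_
    have hs'' : s' ∈ arc f w c ∨ s' = w ∨ s' = c := by
      rcases hs' with rfl | h
      · exact Or.inl hsr
      · exact hsep' s hsr s' h
    rcases hs'' with h | rfl | rfl
    · exact (hshort w hur hsep' s' h).mono (by omega)
    · exact canCatch_left _ _ _
    · rcases hbc with rfl | hbc
      · exact canCatch_right _ _ _
      · have : 2 * m + 1 + G.dist a b + k = (2 * m + G.dist a b + k) + 1 := by omega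
        rw [this]
        exact (canCatch_of_adj _ _ hbc).swap

theorem ncard_arc_le_left {f : V → ℤ} {a c u : V} {m : ℕ} (hu : u ∈ arc f a c)
    (h : (arc f a c).ncard ≤ m + 1) : (arc f a u).ncard ≤ m := by
  refine Nat.le_of_lt_succ ((Set.ncard_lt_ncard ⟨fun y hy => ?_, fun h => ?_⟩).trans_le h)
  · rw [mem_arc] at *; omega
  · exact notMem_arc_right (h hu)

theorem ncard_arc_le_right {f : V → ℤ} {a c u : V} {m : ℕ} (hu : u ∈ arc f a c)
    (h : (arc f a c).ncard ≤ m + 1) : (arc f u c).ncard ≤ m := by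
  refine Nat.le_of_lt_succ ((Set.ncard_lt_ncard ⟨fun y hy => ?_, fun h => ?_⟩).trans_le h)
  · rw [mem_arc] at *; omega
  · exact notMem_arc_left (h hu)

/-- Two zombies that confine the survivor to an arc with `m` vertices catch it: both on the ends of
the arc, or one on an end and the other next to the other end. -/
theorem canCatch_arc (hG : G.Connected) (m : ℕ) :
    (∀ f : V → ℤ, IsNoncrossing G f → ∀ a c, Separates G (arc f a c) a c →
      (arc f a c).ncard ≤ m → ∀ s ∈ arc f a c,
        CanCatch G (2 * m + G.dist a c) ![a, c] s) ∧
    (∀ f : V → ℤ, IsNoncrossing G f → ∀ a b c, Separates G (arc f a c) a c →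
      (arc f a c).ncard ≤ m → b ∉ arc f a c → G.Adj b c → ∀ s ∈ arc f a c,
        CanCatch G (2 * m + G.dist a b + 2) ![a, b] s) := by
  induction m with
  | zero =>
    have empty : ∀ {f : V → ℤ} {a c s : V}, (arc f a c).ncard ≤ 0 → s ∉ arc f a c := by
      intro f a c s h
      rw [Nat.le_zero, Set.ncard_eq_zero] at h
      simp [h]
    exact ⟨fun _ _ _ _ _ h _ hs => absurd hs (empty h),
      fun _ _ _ _ _ _ h _ _ _ hs => absurd hs (empty h)⟩
  | succ m ih =>
    obtain ⟨ih₁, ih₂⟩ := ih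
    have hu : ∀ {f : V → ℤ}, IsNoncrossing G f → ∀ {a c}, (arc f a c).ncard ≤ m + 1 →
        ∀ u ∈ arc f a c, G.Adj a u → ∀ t ∈ arc f a u, CanCatch G (2 * m + 1) ![a, u] t := by
      intro f hf a c hcard u hu hau t ht
      have := ih₁ f hf a u (hf.separates hau) (ncard_arc_le_left hu hcard) t ht
      rwa [SimpleGraph.dist_eq_one_iff_adj.2 hau] at this
    -- Both zombies on `a` is the second kind of position with `b = a`, at distance `0`.
    have ha : ∀ {f : V → ℤ}, IsNoncrossing G f → ∀ {a c}, (arc f a c).ncard ≤ m + 1 →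
        ∀ u ∈ arc f a c, G.Adj a u → ∀ t ∈ arc f a u, CanCatch G (2 * m + 2) ![a, a] t := by
      intro f hf a c hcard u hu hau t ht
      have := ih₂ f hf a a u (hf.separates hau) (ncard_arc_le_left hu hcard) notMem_arc_left
        hau t ht
      rwa [SimpleGraph.dist_self] at this
    have near : ∀ f : V → ℤ, IsNoncrossing G f → ∀ a c, Separates G (arc f a c) a c →
        (arc f a c).ncard ≤ m + 1 → ∀ s ∈ arc f a c, G.dist a s ≤ G.dist c s →
          CanCatch G (2 * (m + 1) + G.dist a c) ![a, c] s := by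
      intro f hf a c hsep hcard s hs hd
      exact canCatch_of_dist_le hG hf (k := 0) hsep notMem_arc_right (Or.inl rfl) hcard
        (hu hf hcard) (ha hf hcard)
        (fun u hu hsep' t ht => ih₁ f hf u c hsep' (ncard_arc_le_right hu hcard) t ht) hs hd
    have both : ∀ f : V → ℤ, IsNoncrossing G f → ∀ a c, Separates G (arc f a c) a c →
        (arc f a c).ncard ≤ m + 1 → ∀ s ∈ arc f a c,
          CanCatch G (2 * (m + 1) + G.dist a c) ![a, c] s := by
      intro f hf a c hsep hcard s hs
      rcases le_total (G.dist a s) (G.dist c s) with hd | hd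
      · exact near f hf a c hsep hcard s hs hd
      · have := near (-f) hf.neg c a (by
          rw [arc_neg]
          intro x hx y hxy
          have := hsep x hx y hxy
          tauto) (by rwa [arc_neg]) s (by rwa [arc_neg]) hd
        rw [G.dist_comm]
        exact this.swap
    refine ⟨both, fun f hf a b c hsep hcard hb hbc s hs => ?_⟩
    have hbc1 := SimpleGraph.dist_eq_one_iff_adj.2 hbc
    have htri := hG.dist_triangle (u := a) (v := b) (w := c)
    have htri' := hG.dist_triangle (u := b) (v := c) (w := s)
    -- Stepping to `c` costs one round, plus at most one more as `dist a c ≤ dist a b + 1`. If that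
    -- step is illegal, the shortest path from `b` runs through `a`, so `a` is no farther from `s`
    -- than `c`.
    by_cases hd : G.dist c s + 1 = G.dist b s
    · refine canCatch_pair_succ (r := 2 * (m + 1) + G.dist a b + 1) (Or.inl rfl)
        (zombieStep_of_dist hG hbc hd) fun _ _ s' hs' => ?_
      have hs'' : s' ∈ arc f a c ∨ s' = a ∨ s' = c := by
        rcases hs' with rfl | h
        · exact Or.inl hs
        · exact hsep s hs s' h
      rcases hs'' with h | rfl | rfl
      · exact (both f hf a c hsep hcard s' h).mono (by omega)
      · exact canCatch_left _ _ _
      · exact canCatch_right _ _ _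
    · refine canCatch_of_dist_le hG hf hsep hb (Or.inr hbc) hcard (hu hf hcard) (ha hf hcard)
        (fun u hu hsep' t ht => ih₂ f hf u b c hsep' (ncard_arc_le_right hu hcard) ?_ hbc t ht)
        hs ?_
      · intro h
        apply hb
        rw [mem_arc] at *
        omega
      · rcases hsep.dist_eq hG hs hb with h | h <;> omega

theorem IsNoncrossing.catchInRounds [Fintype V] (hG : G.Connected) {f : V → ℤ}
    (hf : IsNoncrossing G f) :
    CatchInRounds G 2 (2 * Fintype.card V - 1) := by
  obtain ⟨v⟩ := hG.nonempty
  rcases subsingleton_or_nontrivial V with hV | hV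
  · have : Fintype.card V = 1 := Fintype.card_eq_one_iff.2 ⟨v, fun x => Subsingleton.elim _ _⟩
    rw [this]
    exact ⟨![v, v], fun s => ⟨0, Subsingleton.elim _ _⟩⟩
  obtain ⟨w, hwv⟩ := exists_ne v
  obtain ⟨u, hvu, -⟩ := exists_adj_dist_succ hG hwv.symm
  have hcard : Fintype.card V = (Fintype.card V - 2) + 2 := by
    have := Fintype.one_lt_card (α := V)
    omega
  have hm : ∀ {a c}, a ≠ c → (arc f a c).ncard ≤ Fintype.card V - 2 := by
    intro a c hac
    have h1 : (arc f a c).ncard + ({a, c} : Set V).ncard ≤ (Set.univ : Set V).ncard := by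
      rw [← Set.ncard_union_eq]
      · exact Set.ncard_le_ncard (Set.subset_univ _)
      · rw [Set.disjoint_right]
        rintro x (rfl | rfl)
        · exact notMem_arc_left
        · exact notMem_arc_right
    rw [Set.ncard_pair hac, Set.ncard_univ, Nat.card_eq_fintype_card] at h1
    omega
  have edge : ∀ {a c}, G.Adj a c → ∀ s ∈ arc f a c,
      CanCatch G (2 * (Fintype.card V - 2) + 2) ![a, c] s := by
    intro a c hac s hs
    have := (canCatch_arc hG _).1 f hf a c (hf.separates hac) (hm hac.ne) s hs
    rw [SimpleGraph.dist_eq_one_iff_adj.2 hac] at this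
    -- The spare round gives the uniform bound `2n - 1`, which also holds for `n = 1`, where round
    -- `0` alone is needed.
    exact this.succ
  have hN : 2 * Fintype.card V - 1 = 2 * (Fintype.card V - 2) + 2 + 1 := by omega
  rw [hN]
  refine ⟨![v, u], fun s => ?_⟩
  by_cases hsv : s = v
  · exact hsv ▸ canCatch_left _ _ _
  by_cases hsu : s = u
  · exact hsu ▸ canCatch_right _ _ _
  by_cases hs : s ∈ arc f v u
  · exact edge hvu s hs
  · refine (edge hvu.symm s ?_).swap
    have h1 := hf.1.ne hsv
    have h2 := hf.1.ne hsu
    have h3 := hf.1.ne hvu.ne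
    rw [mem_arc] at *
    omega

/-! ### Chords of the unit circle. -/

/-- Twice the signed area of an inscribed triangle factors into sines of half the angle differences,
all in `(0, π)`. -/
theorem circle_area_pos {α β γ : ℝ} (h1 : α < β) (h2 : β < γ) (h3 : γ - α < 2 * Real.pi) :
    0 < (Real.cos β - Real.cos α) * (Real.sin γ - Real.sin α) -
      (Real.cos γ - Real.cos α) * (Real.sin β - Real.sin α) := by
  have key : (Real.cos β - Real.cos α) * (Real.sin γ - Real.sin α) -
      (Real.cos γ - Real.cos α) * (Real.sin β - Real.sin α) =
      4 * Real.sin ((β - α) / 2) * Real.sin ((γ - β) / 2) * Real.sin ((γ - α) / 2) := by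
    rw [Real.cos_sub_cos, Real.cos_sub_cos, Real.sin_sub_sin, Real.sin_sub_sin]
    have e : (γ - β) / 2 = (γ + α) / 2 - (β + α) / 2 := by ring
    rw [e, Real.sin_sub ((γ + α) / 2)]
    ring
  rw [key]
  have p1 := Real.sin_pos_of_pos_of_lt_pi (x := (β - α) / 2) (by linarith) (by linarith)
  have p2 := Real.sin_pos_of_pos_of_lt_pi (x := (γ - β) / 2) (by linarith) (by linarith)
  have p3 := Real.sin_pos_of_pos_of_lt_pi (x := (γ - α) / 2) (by linarith) (by linarith)
  positivity

theorem mem_openSegment_of_weights {a b x : ℂ} {s t : ℝ} (hs : 0 < s) (ht : 0 < t)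
    (hre : s * a.re + t * b.re = (s + t) * x.re) (him : s * a.im + t * b.im = (s + t) * x.im) :
    x ∈ openSegment ℝ a b := by
  refine ⟨s / (s + t), t / (s + t), by positivity, by positivity, by field_simp, ?_⟩
  apply Complex.ext
  · simp only [Complex.add_re, Complex.real_smul, Complex.re_ofReal_mul]
    field_simp
    linarith
  · simp only [Complex.add_im, Complex.real_smul, Complex.im_ofReal_mul]
    field_simp
    linarith

theorem re_eq_cos_arg {z : ℂ} (h : z ∈ Metric.sphere (0 : ℂ) 1) : z.re = Real.cos z.arg := by
  have h1 : ‖z‖ = 1 := by simpa using h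
  rw [Complex.cos_arg (norm_ne_zero_iff.1 (by simp [h1])), h1, div_one]

theorem im_eq_sin_arg {z : ℂ} (h : z ∈ Metric.sphere (0 : ℂ) 1) : z.im = Real.sin z.arg := by
  have h1 : ‖z‖ = 1 := by simpa using h
  rw [Complex.sin_arg, h1, div_one]

/-- Interlacing chords of the unit circle meet. -/
theorem not_disjoint_chords {a b c d : ℂ} (ha : a ∈ Metric.sphere (0 : ℂ) 1)
    (hb : b ∈ Metric.sphere (0 : ℂ) 1) (hc : c ∈ Metric.sphere (0 : ℂ) 1)
    (hd : d ∈ Metric.sphere (0 : ℂ) 1) (hab : a.arg < b.arg) (hbc : b.arg < c.arg)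
    (hcd : c.arg < d.arg) : ¬ Disjoint (openSegment ℝ a c) (openSegment ℝ b d) := by
  have h1 := Complex.neg_pi_lt_arg a
  have h2 := Complex.arg_le_pi d
  have A := circle_area_pos hbc hcd (by linarith)
  have B := circle_area_pos (hab.trans hbc) hcd (by linarith)
  have C := circle_area_pos hab (hbc.trans hcd) (by linarith)
  have D := circle_area_pos hab hbc (by linarith)
  rw [← re_eq_cos_arg hb, ← re_eq_cos_arg hc, ← re_eq_cos_arg hd, ← im_eq_sin_arg hb,
    ← im_eq_sin_arg hc, ← im_eq_sin_arg hd] at A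
  rw [← re_eq_cos_arg ha, ← re_eq_cos_arg hc, ← re_eq_cos_arg hd, ← im_eq_sin_arg ha,
    ← im_eq_sin_arg hc, ← im_eq_sin_arg hd] at B
  rw [← re_eq_cos_arg ha, ← re_eq_cos_arg hb, ← re_eq_cos_arg hd, ← im_eq_sin_arg ha,
    ← im_eq_sin_arg hb, ← im_eq_sin_arg hd] at C
  rw [← re_eq_cos_arg ha, ← re_eq_cos_arg hb, ← re_eq_cos_arg hc, ← im_eq_sin_arg ha,
    ← im_eq_sin_arg hb, ← im_eq_sin_arg hc] at D
  set α := (c.re - b.re) * (d.im - b.im) - (d.re - b.re) * (c.im - b.im) with hα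
  set β := (c.re - a.re) * (d.im - a.im) - (d.re - a.re) * (c.im - a.im) with hβ
  set γ := (b.re - a.re) * (d.im - a.im) - (d.re - a.re) * (b.im - a.im) with hγ
  set δ := (b.re - a.re) * (c.im - a.im) - (c.re - a.re) * (b.im - a.im) with hδ
  have hsum : α + γ ≠ 0 := by positivity
  rw [Set.not_disjoint_iff]
  -- `α`, `β`, `γ`, `δ` are the doubled areas of `bcd`, `acd`, `abd`, `abc`. The distances of `a`
  -- and `c` from the line `bd` are as `γ : α`, which gives the weights; similarly `β`, `δ` for `b`,
  -- `d`.
  refine ⟨⟨(α * a.re + γ * c.re) / (α + γ), (α * a.im + γ * c.im) / (α + γ)⟩,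
    mem_openSegment_of_weights A C ?_ ?_, mem_openSegment_of_weights B D ?_ ?_⟩
  · simp only
    field_simp
  · simp only
    field_simp
  · simp only
    field_simp
    rw [hα, hβ, hγ, hδ]
    ring
  · simp only
    field_simp
    rw [hα, hβ, hγ, hδ]
    ring

/-! ### The 4-cycle. -/

theorem isOuterplanar_cycleGraph_four : IsOuterplanar (SimpleGraph.cycleGraph 4) := by
  let p : Fin 4 → ℂ := ![1, Complex.I, -1, -Complex.I]
  -- Each open side of the square lies in its own open quadrant.
  have disj : ∀ u x : Fin 4, u ≠ x →
      Disjoint (openSegment ℝ (p u) (p (u + 1))) (openSegment ℝ (p x) (p (x + 1))) := by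
    intro u x hux
    rw [Set.disjoint_left]
    rintro z ⟨s, t, hs, ht, -, h⟩ ⟨s', t', hs', ht', -, h'⟩
    have hre := congrArg Complex.re (h.trans h'.symm)
    have him := congrArg Complex.im (h.trans h'.symm)
    fin_cases u <;> fin_cases x <;> simp [p] at hux hre him <;> linarith
  have adj : ∀ u v : Fin 4, (SimpleGraph.cycleGraph 4).Adj u v →
      ∃ w, openSegment ℝ (p u) (p v) = openSegment ℝ (p w) (p (w + 1)) ∧ s(u, v) = s(w, w + 1) := by
    intro u v h
    have h' : v = u + 1 ∨ u = v + 1 := by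
      revert u v
      decide
    rcases h' with rfl | rfl
    · exact ⟨u, rfl, rfl⟩
    · exact ⟨v, openSegment_symm _ _ _, Sym2.eq_swap⟩
  refine ⟨p, ?_, ?_, ?_⟩
  · intro u v h
    fin_cases u <;> fin_cases v <;> simp [p, Complex.ext_iff] at h ⊢ <;> norm_num at h
  · intro v
    fin_cases v <;> simp [p]
  · intro u v x y huv hxy hne
    obtain ⟨w, hw, hw'⟩ := adj u v huv
    obtain ⟨w', hw₁, hw₁'⟩ := adj x y hxy
    rw [hw, hw₁]
    refine disj w w' ?_
    rintro rfl
    exact hne (hw'.trans hw₁'.symm)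

theorem not_win_one_cycleGraph_four : ¬ Win (SimpleGraph.cycleGraph 4) 1 := by
  have hadj : ∀ a b : Fin 4, (SimpleGraph.cycleGraph 4).Adj a b →
      b ≠ a + 2 ∧ (SimpleGraph.cycleGraph 4).Adj (a + 2) (b + 2) := by decide
  have hne : ∀ a : Fin 4, a ≠ a + 2 := by decide
  -- The survivor copies each zombie move on the opposite side; only adjacency of the moves is used.
  have key : ∀ r (z : Fin 1 → Fin 4), ¬ CanCatch (SimpleGraph.cycleGraph 4) r z (z 0 + 2) := by
    intro r
    induction r with
    | zero =>
      rintro z ⟨i, hi⟩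
      rw [Fin.fin_one_eq_zero i] at hi
      exact hne _ hi
    | succ r ih =>
      rintro z (⟨i, hi⟩ | ⟨z', hz, h⟩)
      · rw [Fin.fin_one_eq_zero i] at hi
        exact hne _ hi
      have hz0 : z' 0 = z 0 ∨ (SimpleGraph.cycleGraph 4).Adj (z 0) (z' 0) :=
        (hz 0).imp_right fun ⟨h, _⟩ => h
      rcases h with ⟨i, hi⟩ | h
      · rw [Fin.fin_one_eq_zero i] at hi
        rcases hz0 with h0 | h0
        · exact hne _ (h0.symm.trans hi)
        · exact (hadj _ _ h0).1 hi
      · refine ih z' (h _ ?_)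
        rcases hz0 with h0 | h0
        · exact Or.inl (by rw [h0])
        · exact Or.inr (hadj _ _ h0).2
  rintro ⟨z, hz⟩
  obtain ⟨r, hr⟩ := hz (z 0 + 2)
  exact key r z hr
-- From drawings to orders, and the lazy zombie number.
theorem exists_isNoncrossing {V : Type*} [Finite V] {G : SimpleGraph V} (h : IsOuterplanar G) :
    ∃ f : V → ℤ, IsNoncrossing G f := by
  obtain ⟨p, hp, hc, hd⟩ := h
  have harg : Function.Injective fun v => (p v).arg := fun u v huv => by
    refine hp (Complex.ext ?_ ?_)
    · rw [re_eq_cos_arg (hc u), re_eq_cos_arg (hc v)]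
      exact congrArg _ huv
    · rw [im_eq_sin_arg (hc u), im_eq_sin_arg (hc v)]
      exact congrArg _ huv
  -- The rank of the argument turns angular order into integer labels.
  let f : V → ℤ := fun v => ({w | (p w).arg < (p v).arg}.ncard : ℕ)
  have hmono : ∀ {u v}, (p u).arg < (p v).arg → f u < f v := by
    intro u v huv
    refine Int.ofNat_lt.2 (Set.ncard_lt_ncard ⟨fun w hw => lt_trans hw huv, fun h => ?_⟩)
    exact lt_irrefl (p u).arg (h huv)
  have hlt : ∀ {u v}, f u < f v → (p u).arg < (p v).arg := by
    intro u v huv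
    by_contra! hle
    rcases hle.lt_or_eq with h | h
    · exact lt_asymm huv (hmono h)
    · rw [harg h] at huv
      exact lt_irrefl _ huv
  refine ⟨f, fun u v huv => ?_, fun a b c d hab hbc hcd hac hbd => ?_⟩
  · by_contra hne
    rcases lt_or_gt_of_ne (harg.ne hne) with h | h
    · exact (hmono h).ne huv
    · exact (hmono h).ne' huv
  · refine not_disjoint_chords (hc a) (hc b) (hc c) (hc d) (hlt hab) (hlt hbc) (hlt hcd)
      (hd a c b d hac hbd fun h => ?_)
    rcases Sym2.eq_iff.1 h with ⟨rfl, -⟩ | ⟨rfl, -⟩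
    · exact lt_irrefl _ hab
    · exact lt_irrefl _ (hab.trans (hbc.trans hcd))

theorem lazyZombieNumber_le {V : Type*} {G : SimpleGraph V} {k : ℕ} (h : Win G k) :
    lazyZombieNumber G ≤ k := Nat.sInf_le h

theorem lazyZombieNumber_eq_two_iff {V : Type*} [Nonempty V] {G : SimpleGraph V} (h : Win G 2) :
    lazyZombieNumber G = 2 ↔ ¬ Win G 1 := by
  have hle := lazyZombieNumber_le h
  have hmem : Win G (lazyZombieNumber G) := Nat.sInf_mem (s := {k | Win G k}) ⟨2, h⟩
  constructor
  · intro h2 h1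
    have := lazyZombieNumber_le h1
    omega
  · intro h1
    generalize lazyZombieNumber G = k at hle hmem
    interval_cases k
    · exact absurd hmem not_win_zero
    · exact absurd hmem h1
    · rfl

theorem _root_.IsOuterplanar.catchInRounds {V : Type*} [Fintype V] {G : SimpleGraph V}
    (h : IsOuterplanar G) (hG : G.Connected) : CatchInRounds G 2 (2 * Fintype.card V - 1) :=
  let ⟨_, hf⟩ := exists_isNoncrossing h
  hf.catchInRounds hG

end LazyZombies

theorem theorem6 :
    (∀ (V : Type*) [Fintype V] (G : SimpleGraph V), G.Connected → IsOuterplanar G →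
      LazyZombies.lazyZombieNumber G ≤ 2 ∧
      (LazyZombies.lazyZombieNumber G = 2 ↔ ¬ LazyZombies.Win G 1) ∧
      ∃ N : ℕ, N < 2 * Fintype.card V ∧ LazyZombies.CatchInRounds G 2 N) ∧
    ((SimpleGraph.cycleGraph 4).Connected ∧ IsOuterplanar (SimpleGraph.cycleGraph 4) ∧
      LazyZombies.lazyZombieNumber (SimpleGraph.cycleGraph 4) = 2) := by
  have hC : (SimpleGraph.cycleGraph 4).Connected := SimpleGraph.cycleGraph_connected
  refine ⟨fun V _ G hG hO => ?_, hC, isOuterplanar_cycleGraph_four, ?_⟩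
  · have hN := hO.catchInRounds hG
    have := hG.nonempty
    have := Fintype.card_pos (α := V)
    exact ⟨lazyZombieNumber_le hN.win, lazyZombieNumber_eq_two_iff hN.win, _, by omega, hN⟩
  · exact (lazyZombieNumber_eq_two_iff (isOuterplanar_cycleGraph_four.catchInRounds hC).win).2
      not_win_one_cycleGraph_four
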